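/- Fix $z>0$. *Restaurants.* Let $\pi^z$ be the Poisson point process on $(0,\infty)$ with intensity $d\nu^z(x)=z\,x^{-1}e^{-x}\,dx$. Almost surely its points $s_1,s_2,\dots$ form a countable infinite set with finite sum; put $\ell_\omega=s_\omega/\sum_j s_j$ (the law of the unordered collection $\{\ell_\omega\}$ is the Poisson–Dirichlet distribution). Given $\{\ell_\omega\}$, take oriented circles (tables) $U_\omega$ of lengths $\ell_\omega$ and choose points (guests) $\bar 1,\bar 2,\bar 3,\dots$ of $\bigsqcup_\omega U_\omega$ independently and uniformly with respect to the Lebesgue measure. Tables are unordered, and configurations of guests are considered up to rotations of tables. The space of all such restaurants with an infinite sequence of guests, with the law $\mu^z$ of the random restaurant just described, is the space of virtual permutations $\mathfrak S^z$. For $n\ge 0$, the space of restaurants with guests $\bar 1,\dots,\bar n$ only, chosen in the same way, is denoted by $\mathfrak S^z_n$, and its measure by $\bar\mu^z_n$. Let $\pi_n:\mathfrak S^z\to\mathfrak S^z_n$ be the map removing the guests $\overline{n+1},\overline{n+2},\dots$; it sends $\mu^z$ to $\bar\mu^z_n$. *Invariant sets.* The group of all permutations of $\mathbb N$ acts on $\mathfrak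 S^z$ by measure preserving transformations, permuting the guests; let $\mathbb K_n$ be the subgroup of permutations $g$ with $g(1)=1,\dots,g(n)=n$. Let $\Sigma[n]$ be the $\sigma$-algebra of measurable sets $B\subset\mathfrak S^z$ such that $\mu^z(B\triangle gB)=0$ for all $g\in\mathbb K_n$. Let $\mathfrak S^z[n]$ be the quotient of the measure space $\mathfrak S^z$ by the measurable partition determined by $\Sigma[n]$: for a sequence $C_j\in\Sigma[n]$ whose indicator functions are dense in $L^2$ among the indicator functions of elements of $\Sigma[n]$, two points $x,x'$ belong to the same element of the partition if $x\in C_j\Leftrightarrow x'\in C_j$ for all $j$. **Proposition.** For every $n\ge0$, $$\mathfrak S^z[n]=\mathfrak S^z_n .$$ That is: 1. $(\mathfrak S^z_n,\bar\mu^z_n)$ is the quotient, via $\pi_n$, of $(\mathfrak S^z,\mu^z)$ by the partition into the fibres of $\pi_n$ (the map $\pi_n$ is surjective, a subset of $\mathfrak S^z_n$ is measurable if and only if its preimage is, and $\bar\mu^z_n$ is the image of $\mu^z$); sequences $C_j$ as above exist, and for each of them the partition of $\mathfrak S^z$ determined by $C_j$ coincides, after removing a set of measure zero, with the partition into the fibres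 of $\pi_n$. 2. A set $B\subset\mathfrak S^z$ belongs to $\Sigma[n]$ if and only if it is measurable and $\mu^z\bigl(B\triangle\pi_n^{-1}(E)\bigr)=0$ for some measurable $E\subset\mathfrak S^z_n$. 3. The space of $\mathbb K_n$-fixed vectors in $L^2(\mathfrak S^z)$ is exactly $L^2(\mathfrak S^z_n)$, embedded by $h\mapsto h\circ\pi_n$. -/

import Mathlib

open MeasureTheory ProbabilityTheory
open scoped ENNReal

noncomputable section

namespace Restaurant

/-! ### The Poisson point process on `(0, ∞)` with intensity `z x⁻¹ e⁻ˣ dx` -/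

/-- The measure `dν^z(x) = z x⁻¹ e⁻ˣ dx` on the half-line `x > 0`. -/
def intensity (z : ℝ) : Measure ℝ :=
  (volume.restrict (Set.Ioi 0)).withDensity
    (fun x => ENNReal.ofReal (z * x⁻¹ * Real.exp (-x)))

/-- A partition of `(0, ∞)` into countably many pieces of finite `ν^z`-measure:
`[1, ∞)`, `[1/2, 1)`, `[1/4, 1/2)`, … -/
def piece : ℕ → Set ℝ
  | 0 => Set.Ici 1
  | k + 1 => Set.Ico ((1 / 2) ^ (k + 1)) ((1 / 2) ^ k)

lemma measurableSet_piece (k : ℕ) : MeasurableSet (piece k) := by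
  cases k
  · exact measurableSet_Ici
  · exact measurableSet_Ico

lemma piece_subset (k : ℕ) : piece k ⊆ Set.Ici ((1 / 2 : ℝ) ^ k) := by
  cases k
  · simp [piece]
  · exact fun x hx => hx.1

lemma volume_piece_ne_zero (k : ℕ) : volume (piece k) ≠ 0 := by
  cases k with
  | zero => simp [piece]
  | succ k =>
    simp only [piece, Real.volume_Ico, ne_eq, ENNReal.ofReal_eq_zero, not_le, sub_pos]
    exact pow_lt_pow_right_of_lt_one₀ (by norm_num) (by norm_num) (Nat.lt_succ_self k)

lemma intensity_piece (z : ℝ) (k : ℕ) : intensity z (piece k) =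
    ∫⁻ x in piece k, ENNReal.ofReal (z * x⁻¹ * Real.exp (-x)) := by
  have hsub : piece k ⊆ Set.Ioi 0 := fun x hx =>
    lt_of_lt_of_le (by positivity : (0 : ℝ) < (1 / 2) ^ k) (piece_subset k hx)
  rw [intensity, withDensity_apply _ (measurableSet_piece k),
    Measure.restrict_restrict (measurableSet_piece k), Set.inter_eq_left.2 hsub]

lemma intensity_piece_ne_zero {z : ℝ} (hz : 0 < z) (k : ℕ) : intensity z (piece k) ≠ 0 := by
  rw [intensity_piece]
  intro h
  rw [lintegral_eq_zero_iff (by fun_prop)] at h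
  have h2 : ∀ᵐ x ∂(volume.restrict (piece k)), x ∈ piece k :=
    ae_restrict_mem (measurableSet_piece k)
  have h3 : ∀ᵐ x ∂(volume.restrict (piece k)), False := by
    filter_upwards [h, h2] with x hx hxk
    have hx0 : 0 < x := lt_of_lt_of_le (by positivity) (piece_subset k hxk)
    have : 0 < z * x⁻¹ * Real.exp (-x) := by positivity
    simp only [Pi.zero_apply, ENNReal.ofReal_eq_zero] at hx
    linarith
  have h4 : volume.restrict (piece k) = 0 := by
    simpa [ae_iff] using h3
  exact volume_piece_ne_zero k (by simpa using h4)

lemma intensity_piece_ne_top {z : ℝ} (hz : 0 < z) (k : ℕ) : intensity z (piece k) ≠ ∞ := by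
  rw [intensity_piece]
  refine ne_top_of_le_ne_top ?_
    (lintegral_mono_set (piece_subset k))
  refine ne_top_of_le_ne_top ?_ (setLIntegral_mono (g := fun x =>
    ENNReal.ofReal (z * 2 ^ k * Real.exp (-x))) (by fun_prop) ?_)
  · have hi : IntegrableOn (fun x : ℝ => z * 2 ^ k * Real.exp (-x)) (Set.Ici ((1 / 2) ^ k)) := by
      rw [integrableOn_Ici_iff_integrableOn_Ioi]
      exact (integrableOn_exp_neg_Ioi _).const_mul _
    rw [← ofReal_integral_eq_lintegral_ofReal hi
      (Filter.Eventually.of_forall fun x => by positivity)]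
    exact ENNReal.ofReal_ne_top
  · intro x hx
    have hx1 : (1 / 2 : ℝ) ^ k ≤ x := hx
    have hx2 : x⁻¹ ≤ 2 ^ k := by
      have := inv_anti₀ (by positivity) hx1
      simpa using this
    gcongr

/-- The law of the raw data of the Poisson process: independently for every piece `k`, a number
`N_k` distributed according to the Poisson law of mean `ν^z (piece k)`, and a sequence `X_{k,0}`,
`X_{k,1}`, … of independent points with law `ν^z` conditioned on that piece. -/
def rawLaw (z : ℝ) : Measure (ℕ → ℕ × (ℕ → ℝ)) :=
  Measure.infinitePi fun k =>
    (poissonMeasure (intensity z (piece k)).toNNReal).prod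
      (Measure.infinitePi fun _ : ℕ => (intensity z)[|piece k])

instance (z : ℝ) [hz : Fact (0 < z)] : IsProbabilityMeasure (rawLaw z) := by
  have h (k : ℕ) : IsProbabilityMeasure ((intensity z)[|piece k]) :=
    cond_isProbabilityMeasure_of_finite (intensity_piece_ne_zero hz.out k)
      (intensity_piece_ne_top hz.out k)
  unfold rawLaw
  infer_instance

/-- The Poisson configuration consists of the points `X_{k,j}` with `j < N_k`. The pair `(k, j)`
is coded by the natural number `Nat.pair k j`; this says that the code belongs to a point. -/
def IsPoint (w : ℕ → ℕ × (ℕ → ℝ)) (m : ℕ) : Prop := m.unpair.2 < (w m.unpair.1).1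

/-- An enumeration of the points `X_{k,j}`, `j < N_k`, of the Poisson configuration (almost surely
there are infinitely many of them). -/
def points (w : ℕ → ℕ × (ℕ → ℝ)) (i : ℕ) : ℝ :=
  (w (Nat.nth (IsPoint w) i).unpair.1).2 (Nat.nth (IsPoint w) i).unpair.2

open Classical in
lemma nth_eq_iff (p : ℕ → Prop) (i m : ℕ) : Nat.nth p i = m ↔
    (p m ∧ Nat.count p m = i) ∨ (m = 0 ∧ ∀ k, ¬ (p k ∧ Nat.count p k = i)) := by
  by_cases h : ∃ k, p k ∧ Nat.count p k = i
  · obtain ⟨k, hk, rfl⟩ := h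
    rw [Nat.nth_count hk]
    constructor
    · rintro rfl
      exact Or.inl ⟨hk, rfl⟩
    · rintro (⟨hm, h⟩ | ⟨-, h⟩)
      · exact (Nat.count_injective hm hk h).symm
      · exact absurd ⟨hk, rfl⟩ (h k)
  · push Not at h
    have h0 : Nat.nth p i = 0 := by
      by_contra hne
      have hi : ∀ hf : (Set.ofPred p).Finite, i < hf.toFinset.card := by
        intro hf
        by_contra hc
        exact hne (Nat.nth_of_card_le hf (not_lt.1 hc))
      exact h _ (Nat.nth_mem i hi) (Nat.count_nth hi)
    rw [h0]
    constructor
    · rintro rfl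
      exact Or.inr ⟨rfl, fun k hk => h k hk.1 hk.2⟩
    · rintro (⟨hm, hc⟩ | ⟨rfl, -⟩)
      · exact absurd hc (h m hm)
      · rfl

lemma measurable_points : Measurable points := by
  classical
  have hp (m : ℕ) : MeasurableSet {w | IsPoint w m} :=
    measurableSet_lt measurable_const (by fun_prop)
  have hc (m : ℕ) : Measurable fun w => Nat.count (IsPoint w) m := by
    induction m with
    | zero => simp
    | succ m ih =>
      simp only [Nat.count_succ]
      exact ih.add (Measurable.ite (hp m) measurable_const measurable_const)
  have hn (i : ℕ) : Measurable fun w => Nat.nth (IsPoint w) i := by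
    refine measurable_to_countable' fun m => ?_
    have h1 (k : ℕ) : MeasurableSet {w | IsPoint w k ∧ Nat.count (IsPoint w) k = i} :=
      (hp k).inter (hc k (measurableSet_singleton i))
    have : (fun w => Nat.nth (IsPoint w) i) ⁻¹' {m} =
        {w | IsPoint w m ∧ Nat.count (IsPoint w) m = i} ∪
        {w | m = 0 ∧ ∀ k, ¬ (IsPoint w k ∧ Nat.count (IsPoint w) k = i)} := by
      ext w
      exact nth_eq_iff _ _ _
    rw [this]
    refine (h1 m).union ?_
    refine (MeasurableSet.const _).inter ?_
    have : {w | ∀ k, ¬ (IsPoint w k ∧ Nat.count (IsPoint w) k = i)} =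
        ⋂ k, {w | IsPoint w k ∧ Nat.count (IsPoint w) k = i}ᶜ := by
      ext w; simp
    have h2 : MeasurableSet {w | ∀ k, ¬ (IsPoint w k ∧ Nat.count (IsPoint w) k = i)} := by
      rw [this]
      exact MeasurableSet.iInter fun k => (h1 k).compl
    exact h2
  refine measurable_pi_lambda _ fun i => ?_
  have : Measurable fun q : (ℕ → ℕ × (ℕ → ℝ)) × ℕ => (q.1 q.2.unpair.1).2 q.2.unpair.2 :=
    measurable_from_prod_countable_left fun m =>
      (measurable_pi_apply m.unpair.2).comp (measurable_snd.comp (measurable_pi_apply m.unpair.1))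
  exact this.comp (measurable_id.prodMk (hn i))

/-! ### Table lengths and the Poisson–Dirichlet distribution -/

/-- Lengths of countably many labelled tables: positive numbers with sum `1`. (The labels will be
forgotten below, in `SameRestaurant`.) -/
abbrev TableLengths : Type := {l : ℕ → ℝ // (∀ ω, 0 < l ω) ∧ HasSum l 1}

/-- An arbitrary element, used only on a set of probability zero. -/
instance : Inhabited TableLengths :=
  ⟨⟨fun ω => 1 / 2 / 2 ^ ω, fun ω => by positivity, hasSum_geometric_two' 1⟩⟩

open Classical in
/-- The normalization `ℓ_ω = s_ω / ∑ s_j`. -/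
def normalize (s : ℕ → ℝ) : TableLengths :=
  if h : (∀ ω, 0 < s ω) ∧ Summable s then
    ⟨fun ω => s ω / ∑' j, s j,
      fun ω => div_pos (h.1 ω) (h.2.tsum_pos (fun j => (h.1 j).le) 0 (h.1 0)), by
        have := h.2.hasSum.div_const (∑' j, s j)
        rwa [div_self (h.2.tsum_pos (fun j => (h.1 j).le) 0 (h.1 0)).ne'] at this⟩
  else default

lemma measurable_normalize : Measurable normalize := by
  classical
  have hs : MeasurableSet {s : ℕ → ℝ | (∀ ω, 0 < s ω) ∧ Summable s} := by
    have : {s : ℕ → ℝ | (∀ ω, 0 < s ω) ∧ Summable s} =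
        {s | ∀ ω, 0 < s ω} ∩ {s | ∑' ω, ENNReal.ofReal (s ω) ≠ ∞} := by
      ext s
      refine and_congr_right fun h => ?_
      have h' : Summable s ↔ Summable fun ω => (s ω).toNNReal := by
        rw [← NNReal.summable_coe]
        exact summable_congr fun ω => (Real.coe_toNNReal _ (h ω).le).symm
      rw [h']
      exact ENNReal.tsum_coe_ne_top_iff_summable.symm
    rw [this]
    refine MeasurableSet.inter ?_ ?_
    · have : {s : ℕ → ℝ | ∀ ω, 0 < s ω} = ⋂ ω, {s | 0 < s ω} := by
        ext s; simp
      exact this ▸ MeasurableSet.iInter fun ω =>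
        measurableSet_lt measurable_const (measurable_pi_apply ω)
    have hm : Measurable fun s : ℕ → ℝ => ∑' ω, ENNReal.ofReal (s ω) :=
      Measurable.tsum fun ω => by fun_prop
    exact (hm (measurableSet_singleton ∞)).compl
  refine Measurable.subtype_mk (f := fun s => (normalize s).1) ?_ (h := fun s => (normalize s).2)
  refine measurable_pi_lambda _ fun ω => ?_
  have : (fun s => (normalize s).1 ω) = fun s =>
      if (∀ ω, 0 < s ω) ∧ Summable s then s ω / (∑' j, ENNReal.ofReal (s j)).toReal
      else (default : TableLengths).1 ω := by
    ext s
    by_cases h : (∀ ω, 0 < s ω) ∧ Summable s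
    · rw [normalize, dif_pos h, if_pos h, ← ENNReal.ofReal_tsum_of_nonneg (fun j => (h.1 j).le) h.2,
        ENNReal.toReal_ofReal (tsum_nonneg fun j => (h.1 j).le)]
    · rw [normalize, dif_neg h, if_neg h]
  rw [this]
  refine Measurable.ite hs ?_ measurable_const
  exact (measurable_pi_apply ω).div
    (Measurable.tsum fun j => by fun_prop).ennreal_toReal

/-- The Poisson–Dirichlet distribution: the law of the normalized points `s_ω / ∑ s_j` of the
Poisson process with intensity `ν^z`. -/
def poissonDirichlet (z : ℝ) : Measure TableLengths :=
  ((rawLaw z).map points).map normalize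

instance (z : ℝ) [Fact (0 < z)] : IsProbabilityMeasure (poissonDirichlet z) := by
  have := Measure.isProbabilityMeasure_map (μ := rawLaw z) measurable_points.aemeasurable
  exact Measure.isProbabilityMeasure_map measurable_normalize.aemeasurable

/-! ### Guests -/

/-- A point of the disjoint union `⊔ U_ω` of the tables: a label `ω` of a table and a point of the
circle `U_ω`. The circle `U_ω` of length `ℓ_ω` is parametrized proportionally to arc length by the
circle `ℝ / ℤ` of length `1`. -/
abbrev Seat : Type := ℕ × UnitAddCircle

/-- The Lebesgue measure on `⊔ U_ω`; it has mass `ℓ_ω` on the circle `U_ω`. -/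
def seatMeasure (l : TableLengths) : Measure Seat :=
  Measure.sum fun ω => ENNReal.ofReal (l.1 ω) • (volume : Measure UnitAddCircle).map (Prod.mk ω)

lemma isProbabilityMeasure_circle : IsProbabilityMeasure (volume : Measure UnitAddCircle) :=
  ⟨UnitAddCircle.measure_univ⟩

instance (l : TableLengths) : IsProbabilityMeasure (seatMeasure l) := by
  constructor
  have h (ω : ℕ) : (volume : Measure UnitAddCircle).map (Prod.mk ω) Set.univ = 1 := by
    rw [Measure.map_apply measurable_prodMk_left .univ]
    exact UnitAddCircle.measure_univ
  simp only [seatMeasure, Measure.sum_apply _ MeasurableSet.univ, Measure.smul_apply, h,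
    smul_eq_mul, mul_one]
  rw [← ENNReal.ofReal_tsum_of_nonneg (fun ω => (l.2.1 ω).le) l.2.2.summable, l.2.2.tsum_eq,
    ENNReal.ofReal_one]

lemma measurable_seatMeasure {A : Set Seat} (hA : MeasurableSet A) :
    Measurable fun l => seatMeasure l A := by
  simp only [seatMeasure, Measure.sum_apply _ hA, Measure.smul_apply, smul_eq_mul]
  refine Measurable.tsum fun ω => ?_
  exact (((measurable_pi_apply ω).comp measurable_subtype_coe).ennreal_ofReal).mul_const _

/-- Restaurants with labelled tables and guests named by a set `I`: table lengths and the seats of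
the guests. -/
abbrev Labelled (I : Type) : Type := TableLengths × (I → Seat)

/-- Given the tables, the guests take independent seats, uniformly distributed on `⊔ U_ω`. -/
def guestKernel (I : Type) : Kernel TableLengths (I → Seat) where
  toFun l := Measure.infinitePi fun _ : I => seatMeasure l
  measurable' := by
    refine Measurable.measure_of_isPiSystem_of_isProbabilityMeasure
      (S := squareCylinders fun _ : I => {s : Set Seat | MeasurableSet s})
      generateFrom_squareCylinders.symm
      (isPiSystem_squareCylinders (fun _ => MeasurableSpace.isPiSystem_measurableSet)
        (fun _ => by simp)) ?_
    rintro _ ⟨s, t, ht, rfl⟩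
    have ht' (i : I) : MeasurableSet (t i) := by simpa using ht i
    simp only [Measure.infinitePi_pi _ (fun i _ => ht' i)]
    exact Finset.measurable_prod _ fun i _ => measurable_seatMeasure (ht' i)

instance (I : Type) : IsMarkovKernel (guestKernel I) :=
  ⟨fun l => by change IsProbabilityMeasure (Measure.infinitePi fun _ : I => seatMeasure l)
               infer_instance⟩

/-- The law of a random restaurant with labelled tables and guests named by `I`. -/
def labelledLaw (z : ℝ) (I : Type) : Measure (Labelled I) :=
  (poissonDirichlet z).compProd (guestKernel I)

/-- Two labelled restaurants are the same if they differ by a relabelling `σ` of the tables (which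
preserves their lengths) and by rotations of the tables. -/
def SameRestaurant {I : Type} (a b : Labelled I) : Prop :=
  ∃ (σ : Equiv.Perm ℕ) (ρ : ℕ → UnitAddCircle), (∀ ω, b.1.1 (σ ω) = a.1.1 ω) ∧
    ∀ i, b.2 i = (σ (a.2 i).1, (a.2 i).2 + ρ (a.2 i).1)

/-- `SameRestaurant` as an equivalence relation. -/
def restaurantSetoid (I : Type) : Setoid (Labelled I) where
  r := SameRestaurant
  iseqv :=
    { refl := fun a => ⟨1, 0, fun _ => rfl, fun i => by simp⟩
      symm := by
        rintro a b ⟨σ, ρ, h1, h2⟩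
        refine ⟨σ⁻¹, fun ω => -ρ (σ⁻¹ ω), fun ω => ?_, fun i => ?_⟩
        · rw [← h1]; simp
        · rw [h2 i]; simp
      trans := by
        rintro a b c ⟨σ, ρ, h1, h2⟩ ⟨σ', ρ', h1', h2'⟩
        refine ⟨σ' * σ, fun ω => ρ ω + ρ' (σ ω), fun ω => ?_, fun i => ?_⟩
        · rw [← h1, ← h1']; rfl
        · rw [h2' i, h2 i]; simp [add_assoc] }

/-- Restaurants with guests named by `I`: an unordered collection of circles with guests, up to
rotations of the circles. It carries the quotient `σ`-algebra. -/
abbrev Occupied (I : Type) : Type := Quotient (restaurantSetoid I)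

/-- The law of a random restaurant with uniformly seated guests named by `I`. -/
def law (z : ℝ) (I : Type) : Measure (Occupied I) :=
  (labelledLaw z I).map (Quotient.mk (restaurantSetoid I))

/-- Renaming and forgetting guests: the guest `j` of the new restaurant is the guest `f j` of the
old one, and guests outside the range of `f` are removed. -/
def reindex {I J : Type} (f : J → I) : Occupied I → Occupied J :=
  Quotient.map (fun a : Labelled I => ((a.1, fun j => a.2 (f j)) : Labelled J))
    (fun _ _ ⟨σ, ρ, h1, h2⟩ => ⟨σ, ρ, h1, fun j => h2 (f j)⟩)

lemma measurable_reindex {I J : Type} (f : J → I) : Measurable (reindex f) := by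
  refine measurable_from_quotient.2 ?_
  have h : Measurable fun a : Labelled I => ((a.1, fun j => a.2 (f j)) : Labelled J) := by
    fun_prop
  exact measurable_quotient_mk''.comp h

instance (z : ℝ) [Fact (0 < z)] (I : Type) : IsProbabilityMeasure (labelledLaw z I) := by
  unfold labelledLaw; infer_instance

instance (z : ℝ) [Fact (0 < z)] (I : Type) : IsProbabilityMeasure (law z I) :=
  Measure.isProbabilityMeasure_map measurable_quotient_mk''.aemeasurable

lemma map_infinitePi_comp {I J : Type} {f : J → I} (hf : Function.Injective f)
    (p : Measure Seat) [IsProbabilityMeasure p] :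
    (Measure.infinitePi fun _ : I => p).map (fun x j => x (f j)) =
      Measure.infinitePi fun _ : J => p := by
  classical
  refine Measure.eq_infinitePi _ fun s t ht => ?_
  rw [Measure.map_apply (by fun_prop) (MeasurableSet.pi s.countable_toSet fun j _ => ht j)]
  have h : (fun (x : I → Seat) j => x (f j)) ⁻¹' Set.pi s t =
      Set.pi (s.map ⟨f, hf⟩) (fun i => ⋂ (j : J) (_ : j ∈ s) (_ : f j = i), t j) := by
    ext x
    simp only [Set.mem_preimage, Set.mem_pi, Finset.mem_coe, Finset.mem_map,
      Function.Embedding.coeFn_mk, Set.mem_iInter]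
    constructor
    · rintro h _ - j hj rfl
      exact h j hj
    · intro h j hj
      exact h (f j) ⟨j, hj, rfl⟩ j hj rfl
  have h' (j : J) (hj : j ∈ s) : (⋂ (j' : J) (_ : j' ∈ s) (_ : f j' = f j), t j') = t j := by
    ext y
    simp only [Set.mem_iInter]
    constructor
    · intro h
      exact h j hj rfl
    · intro h j' _ he
      rwa [hf he]
  rw [h, Measure.infinitePi_pi, Finset.prod_map]
  · exact Finset.prod_congr rfl fun j hj => by
      simp only [Function.Embedding.coeFn_mk, h' j hj]
  · intro i hi
    obtain ⟨j, hj, rfl⟩ := Finset.mem_map.1 hi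
    simp only [Function.Embedding.coeFn_mk, h' j hj]
    exact ht j

lemma measurePreserving_reindex (z : ℝ) [Fact (0 < z)] {I J : Type} {f : J → I}
    (hf : Function.Injective f) : MeasurePreserving (reindex f) (law z I) (law z J) := by
  refine ⟨measurable_reindex f, ?_⟩
  have hm : Measurable fun (x : I → Seat) (j : J) => x (f j) := by fun_prop
  have hk : (guestKernel I).map (fun (x : I → Seat) (j : J) => x (f j)) = guestKernel J := by
    ext1 l
    rw [Kernel.map_apply _ hm]
    exact map_infinitePi_comp hf (seatMeasure l)
  have hl : (labelledLaw z I).map (Prod.map id fun (x : I → Seat) (j : J) => x (f j)) =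
      labelledLaw z J := by
    rw [labelledLaw, ← Measure.compProd_map hm, hk, labelledLaw]
  rw [law, law, ← hl, Measure.map_map (measurable_reindex f) measurable_quotient_mk'',
    Measure.map_map measurable_quotient_mk'' (by fun_prop)]
  rfl

/-! ### The space of virtual permutations, half-empty restaurants, and the group `K_n` -/

/-- The space of virtual permutations, i.e. of restaurants with an infinite sequence of guests. The
guest with the number `i + 1` is denoted here by `i : ℕ`. -/
abbrev VirtualPerm : Type := Occupied ℕ

/-- The space of restaurants with the first `n` guests only. -/
abbrev HalfEmpty (n : ℕ) : Type := Occupied (Fin n)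

/-- The removal of all guests except the first `n` ones. -/
def forget (n : ℕ) : VirtualPerm → HalfEmpty n := reindex Fin.val

/-- The action of a permutation of `ℕ` on virtual permutations: the guest `i` is renamed `g i`. -/
def permute (g : Equiv.Perm ℕ) : VirtualPerm → VirtualPerm := reindex ⇑(g⁻¹)

lemma measurePreserving_forget (z : ℝ) [Fact (0 < z)] (n : ℕ) :
    MeasurePreserving (forget n) (law z ℕ) (law z (Fin n)) :=
  measurePreserving_reindex z Fin.val_injective

lemma measurePreserving_permute (z : ℝ) [Fact (0 < z)] (g : Equiv.Perm ℕ) :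
    MeasurePreserving (permute g) (law z ℕ) (law z ℕ) :=
  measurePreserving_reindex z (Equiv.injective _)

/-- The group `K_n` of all permutations of `ℕ` (of arbitrary support) that fix the first `n`
elements. -/
def fixFirst (n : ℕ) : Subgroup (Equiv.Perm ℕ) where
  carrier := {g | ∀ i < n, g i = i}
  one_mem' := fun _ _ => rfl
  mul_mem' := fun {a b} ha hb i hi => by
    rw [Equiv.Perm.mul_apply, hb i hi, ha i hi]
  inv_mem' := fun {a} ha i hi => by
    rw [Equiv.Perm.inv_eq_iff_eq, ha i hi]

/-- The `σ`-algebra of `K_n`-invariant sets: measurable sets `B` such that `B` and its translate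
by `g` differ by a null set for every `g ∈ K_n`. -/
def invariantSets (z : ℝ) (n : ℕ) : Set (Set VirtualPerm) :=
  {B | MeasurableSet B ∧ ∀ g ∈ fixFirst n, law z ℕ (symmDiff B (permute g ⁻¹' B)) = 0}

/-! ### Quotients of measure spaces by `σ`-algebras -/

/-- `C j` is a sequence of elements of the `σ`-algebra `S` whose indicator functions are dense in
the set of indicator functions of elements of `S`, in the sense of `L²`, where the squared distance
of two indicator functions is the measure of the symmetric difference. -/
def IsDenseSeq {X : Type*} [MeasurableSpace X] (μ : Measure X) (S : Set (Set X))
    (C : ℕ → Set X) : Prop :=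
  (∀ j, C j ∈ S) ∧ ∀ B ∈ S, ∀ ε : ℝ≥0∞, 0 < ε → ∃ j, μ (symmDiff B (C j)) < ε

/-- The measure space `(Y, ν)` is, via `π`, the quotient of the measure space `(X, μ)` by the
measurable partition which a `σ`-algebra `S` of measurable subsets of `X` determines.

The first three fields say that `(Y, ν)` is the quotient of `(X, μ)` by the partition into the
fibres of `π`. The partition determined by `S` is the one into the classes of the relation
`x ∼ y ↔ ∀ j, (x ∈ C j ↔ y ∈ C j)`, where `C` is a dense sequence in `S`; the last two fields say
that there is such a sequence and that, for every such sequence, this partition and the one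
into the fibres of `π` coincide after removing a null set. -/
structure IsQuotientSpace {X Y : Type*} [MeasurableSpace X] [MeasurableSpace Y] (μ : Measure X)
    (S : Set (Set X)) (π : X → Y) (ν : Measure Y) : Prop where
  surjective : Function.Surjective π
  measurableSet_iff : ∀ E : Set Y, MeasurableSet E ↔ MeasurableSet (π ⁻¹' E)
  map_eq : μ.map π = ν
  exists_dense : ∃ C, IsDenseSeq μ S C
  partition_eq : ∀ C, IsDenseSeq μ S C → ∃ X₀ : Set X, MeasurableSet X₀ ∧ μ X₀ᶜ = 0 ∧
    ∀ x ∈ X₀, ∀ y ∈ X₀, (∀ j, x ∈ C j ↔ y ∈ C j) ↔ π x = π y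

end Restaurant

end

namespace Restaurant

/-! Condition on the table lengths `l` and on the seats `y` of the first `n` guests. The other
guests then take independent seats with the common law `seatMeasure l`, and `fixFirst n` contains
permutations that move them alone. By the Hewitt–Savage law an invariant function is almost surely
constant in their seats, hence equal to its mean `guestMean` over them. Countably many permutations,
the block swaps, suffice for this, so all exceptional null sets can be united before conditioning.
Relabelling and rotating tables transports the law of the extra guests, so the mean depends only on
the restaurant with `n` guests: this is `exists_ae_eq_comp_forget`. Indicator functions give the
description of the invariant sets, and square integrable functions give the fixed vectors.

The statement on partitions also needs countably many measurable sets separating the points of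
`HalfEmpty n`. They come from `invariants`, which is complete for finitely many guests and takes
values in a countably separated space. Their preimages are limits of members of any dense sequence,
by Borel–Cantelli, so off a null set the dense sequence separates exactly the fibres of `forget n`.
Dense sequences exist because the law of labelled restaurants is separable. -/

/-! ### Independence of disjoint blocks and the Hewitt–Savage law -/

lemma infinitePi_sum {J K : Type} (p : Measure Seat) [IsProbabilityMeasure p] :
    ((Measure.infinitePi fun _ : J => p).prod (Measure.infinitePi fun _ : K => p)).map
      (fun q => Sum.elim q.1 q.2) = Measure.infinitePi fun _ : J ⊕ K => p := by
  have hm : Measurable fun q : (J → Seat) × (K → Seat) => (Sum.elim q.1 q.2 : J ⊕ K → Seat) := by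
    refine measurable_pi_lambda _ ?_
    rintro (j | k) <;> simp <;> fun_prop
  refine Measure.eq_infinitePi _ fun s t ht => ?_
  rw [Measure.map_apply hm (MeasurableSet.pi s.countable_toSet fun j _ => ht j)]
  have h : (fun q : (J → Seat) × (K → Seat) => (Sum.elim q.1 q.2 : J ⊕ K → Seat)) ⁻¹'
      Set.pi s t = (Set.pi s.toLeft fun j => t (.inl j)) ×ˢ
        (Set.pi s.toRight fun k => t (.inr k)) := by
    ext q
    simp [Set.mem_pi, Sum.forall]
  rw [h, Measure.prod_prod, Measure.infinitePi_pi _ fun i _ => ht _,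
    Measure.infinitePi_pi _ fun i _ => ht _]
  conv_rhs => rw [← s.toLeft_disjSum_toRight, Finset.prod_disjSum]

/-- Disjoint blocks of coordinates are independent. Injectivity of `Sum.elim f g` says at once that
no coordinate repeats within a block and that the two blocks are disjoint. -/
lemma map_infinitePi_prodMk {I J K : Type} {f : J → I} {g : K → I}
    (hfg : Function.Injective (Sum.elim f g)) (p : Measure Seat) [IsProbabilityMeasure p] :
    (Measure.infinitePi fun _ : I => p).map (fun x => (x ∘ f, x ∘ g)) =
      (Measure.infinitePi fun _ : J => p).prod (Measure.infinitePi fun _ : K => p) := by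
  have hm : Measurable fun q : (J → Seat) × (K → Seat) => (Sum.elim q.1 q.2 : J ⊕ K → Seat) := by
    refine measurable_pi_lambda _ ?_
    rintro (j | k) <;> simp <;> fun_prop
  have hr : Measurable fun x : J ⊕ K → Seat => (x ∘ Sum.inl, x ∘ Sum.inr) := by fun_prop
  have h := map_infinitePi_comp hfg p
  rw [← infinitePi_sum] at h
  have h2 := congrArg (Measure.map fun x : J ⊕ K → Seat => (x ∘ Sum.inl, x ∘ Sum.inr)) h
  rw [Measure.map_map hr (by fun_prop), Measure.map_map hr hm] at h2
  rw [show ((fun x : J ⊕ K → Seat => (x ∘ Sum.inl, x ∘ Sum.inr)) ∘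
    fun q : (J → Seat) × (K → Seat) => Sum.elim q.1 q.2) = id from rfl, Measure.map_id] at h2
  exact h2

/-- The permutation of `ℕ` exchanging the intervals `[0, k)` and `[k, 2k)`. -/
def blockSwap (k : ℕ) : Equiv.Perm ℕ :=
  Function.Involutive.toPerm (fun i => if i < k then i + k else if i < 2 * k then i - k else i) <| by
    intro i
    dsimp only
    split_ifs <;> omega

lemma blockSwap_of_lt {k i : ℕ} (h : i < k) : blockSwap k i = i + k := if_pos h

/-- The Hewitt–Savage zero-one law. -/
theorem measure_eq_zero_or_one_of_blockSwap (p : Measure Seat) [IsProbabilityMeasure p]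
    {A : Set (ℕ → Seat)} (hA : MeasurableSet A)
    (hinv : ∀ k, (fun x : ℕ → Seat => x ∘ blockSwap k) ⁻¹' A
      =ᵐ[Measure.infinitePi fun _ : ℕ => p] A) :
    (Measure.infinitePi fun _ : ℕ => p) A = 0 ∨ (Measure.infinitePi fun _ : ℕ => p) A = 1 := by
  set μ := Measure.infinitePi fun _ : ℕ => p with hμ
  -- Approximate `A` by a cylinder `C` and swap `C` to disjoint coordinates, which makes it
  -- independent of its copy. Then `μ A = μ (A ∩ g ⁻¹' A)` is within `2ε` of `(μ C)²`, which is
  -- within `2ε` of `(μ A)²`; the constant 5 leaves slack.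
  have key (ε : ℝ) (hε : 0 < ε) : |μ.real A - μ.real A ^ 2| ≤ 5 * ε := by
    obtain ⟨C, hC, hCA⟩ := exists_measure_symmDiff_lt_of_generateFrom_isSetRing (μ := μ)
      (C := measurableCylinders fun _ : ℕ => Seat) (isSetRing_measurableCylinders)
      ⟨{Set.univ}, by simp, by simpa using! univ_mem_measurableCylinders (fun _ : ℕ => Seat), by simp⟩
      generateFrom_measurableCylinders.symm hA (ENNReal.ofReal_pos.2 hε)
    have hCm : MeasurableSet C := MeasurableSet.of_mem_measurableCylinders hC
    obtain ⟨s, S, hS, rfl⟩ := (mem_measurableCylinders _).1 hC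
    set C : Set (ℕ → Seat) := cylinder (α := fun _ => Seat) s S with hCdef
    obtain ⟨k, hk⟩ : ∃ k, ∀ i ∈ s, i < k :=
      ⟨s.sup id + 1, fun i hi => Nat.lt_succ_of_le (Finset.le_sup (f := id) hi)⟩
    set g : (ℕ → Seat) → (ℕ → Seat) := fun x => x ∘ blockSwap k with hg
    have hgm : Measurable g := by fun_prop
    have hgp : MeasurePreserving g μ μ :=
      ⟨hgm, map_infinitePi_comp (blockSwap k).injective p⟩
    have hsd : μ.real (symmDiff C A) ≤ ε := by
      rw [measureReal_def]
      exact ENNReal.toReal_le_of_le_ofReal hε.le hCA.le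
    have hsd' : μ.real (symmDiff (g ⁻¹' C) (g ⁻¹' A)) ≤ ε := by
      rw [← Set.preimage_symmDiff,
        hgp.measureReal_preimage (hCm.symmDiff hA).nullMeasurableSet]
      exact hsd
    have h1 : |μ.real C - μ.real A| ≤ ε :=
      (abs_measureReal_sub_le_measureReal_symmDiff hCm.nullMeasurableSet
        hA.nullMeasurableSet).trans hsd
    have h2 : |μ.real (C ∩ g ⁻¹' C) - μ.real (A ∩ g ⁻¹' A)| ≤ 2 * ε := by
      refine (abs_measureReal_sub_le_measureReal_symmDiff
        (hCm.inter (hgm hCm)).nullMeasurableSet (hA.inter (hgm hA)).nullMeasurableSet).trans ?_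
      have : symmDiff (C ∩ g ⁻¹' C) (A ∩ g ⁻¹' A) ⊆
          symmDiff C A ∪ symmDiff (g ⁻¹' C) (g ⁻¹' A) := by
        intro x
        simp only [Set.mem_symmDiff, Set.mem_inter_iff, Set.mem_union]
        tauto
      have := (measureReal_mono (μ := μ) this).trans (measureReal_union_le _ _)
      linarith
    have h3 : μ.real (A ∩ g ⁻¹' A) = μ.real A := by
      refine measureReal_congr ?_
      have := (Filter.EventuallyEq.refl (ae μ) A).inter (hinv k)
      rwa [Set.inter_self] at this
    -- The base `s` of `C` lies in `[0, k)` and its image under the swap in `[k, 2k)`, so the two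
    -- cylinder conditions are independent.
    have h4 : μ.real (C ∩ g ⁻¹' C) = μ.real C ^ 2 := by
      have hinj : Function.Injective (Sum.elim (fun i : s => (i : ℕ))
          (fun i : s => blockSwap k i)) := by
        rintro (i | i) (j | j) h
        · exact congrArg Sum.inl (Subtype.ext h)
        · have h' : (i : ℕ) = j + k := by simpa [blockSwap_of_lt (hk j j.2)] using h
          have := hk i i.2
          omega
        · have h' : (i : ℕ) + k = j := by simpa [blockSwap_of_lt (hk i i.2)] using h
          have := hk j j.2
          omega
        · exact congrArg Sum.inr (Subtype.ext ((blockSwap k).injective h))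
      have hp := map_infinitePi_prodMk hinj p
      have hCs : C = (fun x : ℕ → Seat => x ∘ fun i : s => (i : ℕ)) ⁻¹' S := rfl
      have hmC : μ C = (Measure.infinitePi fun _ : s => p) S := by
        rw [hCs, ← Measure.map_apply (by fun_prop) hS]
        exact congrArg (· S) (map_infinitePi_comp (f := fun i : s => (i : ℕ))
          Subtype.val_injective p)
      have hmC2 : μ (C ∩ g ⁻¹' C) = μ C * μ C := by
        have : C ∩ g ⁻¹' C = (fun x : ℕ → Seat =>
            (x ∘ fun i : s => (i : ℕ), x ∘ fun i : s => blockSwap k i)) ⁻¹' (S ×ˢ S) := rfl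
        rw [this, ← Measure.map_apply (by fun_prop) (hS.prod hS), hp, Measure.prod_prod, hmC]
      rw [measureReal_def, hmC2, ENNReal.toReal_mul, measureReal_def, sq]
    rw [h3, h4] at h2
    have h5 : μ.real A ≤ 1 := measureReal_le_one
    have h6 : μ.real C ≤ 1 := measureReal_le_one
    have h7 : |μ.real C ^ 2 - μ.real A ^ 2| ≤ 2 * ε := by
      rw [sq_sub_sq, abs_mul]
      refine mul_le_mul ?_ h1 (abs_nonneg _) (by norm_num)
      rw [abs_of_nonneg (by positivity)]
      linarith
    rw [abs_le] at *
    constructor <;> linarith [h2.1, h2.2, h7.1, h7.2]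
  have h0 : μ.real A - μ.real A ^ 2 = 0 := by
    by_contra hne
    have hpos := abs_pos.2 hne
    have := key (|μ.real A - μ.real A ^ 2| / 10) (by positivity)
    linarith
  have h1 : μ.real A * (1 - μ.real A) = 0 := by linarith
  rcases mul_eq_zero.1 h1 with h | h
  · left
    exact (measureReal_eq_zero_iff).1 h
  · right
    rw [← ENNReal.toReal_eq_one_iff]
    exact (sub_eq_zero.1 h).symm

/-- Every preimage of a Borel set has measure 0 or 1, and countably many Borel sets separate the
points of `ℂ`. -/
theorem exists_ae_eq_const_of_blockSwap (p : Measure Seat) [IsProbabilityMeasure p]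
    {f : (ℕ → Seat) → ℂ} (hf : Measurable f)
    (hinv : ∀ k, (fun x => f (x ∘ blockSwap k)) =ᵐ[Measure.infinitePi fun _ : ℕ => p] f) :
    ∃ c, f =ᵐ[Measure.infinitePi fun _ : ℕ => p] fun _ => c := by
  refine Filter.exists_eventuallyEq_const_of_forall_separating MeasurableSet fun U hU => ?_
  have hk (k : ℕ) : (fun x : ℕ → Seat => x ∘ blockSwap k) ⁻¹' (f ⁻¹' U)
      =ᵐ[Measure.infinitePi fun _ : ℕ => p] f ⁻¹' U := by
    filter_upwards [hinv k] with x hx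
    exact congrArg (· ∈ U) hx
  rcases measure_eq_zero_or_one_of_blockSwap p (hf hU) hk with h | h
  · right
    exact measure_eq_zero_iff_ae_notMem.1 h
  · left
    exact (mem_ae_iff_prob_eq_one (hf hU)).2 h

/-! ### Averaging over all guests but the first `n` -/

/-- The sequence which starts with `y` and goes on with `r`. -/
def prepend {n : ℕ} (y : Fin n → Seat) (r : ℕ → Seat) (i : ℕ) : Seat :=
  if h : i < n then y ⟨i, h⟩ else r (i - n)

lemma measurable_prepend (n : ℕ) :
    Measurable fun q : (Fin n → Seat) × (ℕ → Seat) => prepend q.1 q.2 := by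
  refine measurable_pi_lambda _ fun i => ?_
  unfold prepend
  split_ifs <;> fun_prop

lemma prepend_comp_val {n : ℕ} (y : Fin n → Seat) (r : ℕ → Seat) :
    prepend y r ∘ Fin.val = y := by
  ext1 i
  simp [prepend]

lemma prepend_restrict (n : ℕ) (x : ℕ → Seat) :
    prepend (x ∘ (Fin.val : Fin n → ℕ)) (x ∘ (· + n)) = x := by
  ext1 i
  unfold prepend
  split_ifs with h
  · rfl
  · simp [Nat.sub_add_cancel (not_lt.1 h)]

lemma prod_map_prepend (n : ℕ) (p : Measure Seat) [IsProbabilityMeasure p] :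
    ((Measure.infinitePi fun _ : Fin n => p).prod (Measure.infinitePi fun _ : ℕ => p)).map
      (fun q => prepend q.1 q.2) = Measure.infinitePi fun _ : ℕ => p := by
  have hinj : Function.Injective (Sum.elim (Fin.val : Fin n → ℕ) (· + n)) := by
    rintro (i | i) (j | j) h
    · simpa [Fin.ext_iff] using h
    · have h' : (i : ℕ) = j + n := h
      omega
    · have h' : i + n = (j : ℕ) := h
      omega
    · simpa using h
  rw [← map_infinitePi_prodMk hinj p, Measure.map_map (measurable_prepend n) (by fun_prop)]
  convert! Measure.map_id
  ext1 x
  exact prepend_restrict n x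

/-- The permutation of `ℕ` which fixes `[0, n)` and acts by `g` on `[n, ∞)`. -/
def shiftPerm (n : ℕ) (g : Equiv.Perm ℕ) : Equiv.Perm ℕ where
  toFun i := if i < n then i else g (i - n) + n
  invFun i := if i < n then i else g⁻¹ (i - n) + n
  left_inv i := by
    by_cases h : i < n
    · simp [h]
    · simp [h, Nat.sub_add_cancel (not_lt.1 h)]
  right_inv i := by
    by_cases h : i < n
    · simp [h]
    · simp [h, Nat.sub_add_cancel (not_lt.1 h)]

lemma shiftPerm_mem (n : ℕ) (g : Equiv.Perm ℕ) : shiftPerm n g ∈ fixFirst n :=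
  fun _ hi => if_pos hi

lemma prepend_comp_shiftPerm {n : ℕ} (g : Equiv.Perm ℕ) (y : Fin n → Seat) (r : ℕ → Seat) :
    prepend y r ∘ shiftPerm n g = prepend y (r ∘ g) := by
  ext1 i
  by_cases h : i < n <;> simp [prepend, shiftPerm, h]

/-- The relabelling `σ` of the tables together with the rotations `ρ`. -/
def moveSeat (σ : Equiv.Perm ℕ) (ρ : ℕ → UnitAddCircle) (s : Seat) : Seat :=
  (σ s.1, s.2 + ρ s.1)

lemma measurable_moveSeat (σ : Equiv.Perm ℕ) (ρ : ℕ → UnitAddCircle) :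
    Measurable (moveSeat σ ρ) := by
  refine measurable_from_prod_countable_right fun ω => ?_
  unfold moveSeat
  fun_prop

/-- Rotations preserve Haar measure on each circle, and `σ` carries each table to one of the same
mass. -/
lemma seatMeasure_map_moveSeat {σ : Equiv.Perm ℕ} {ρ : ℕ → UnitAddCircle} {l l' : TableLengths}
    (h : ∀ ω, l'.1 (σ ω) = l.1 ω) : (seatMeasure l).map (moveSeat σ ρ) = seatMeasure l' := by
  have hm := measurable_moveSeat σ ρ
  ext A hA
  rw [Measure.map_apply hm hA, seatMeasure, seatMeasure, Measure.sum_apply _ (hm hA),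
    Measure.sum_apply _ hA, ← σ.tsum_eq fun ω =>
      (ENNReal.ofReal (l'.1 ω) • (volume : Measure UnitAddCircle).map (Prod.mk ω)) A]
  refine tsum_congr fun ω => ?_
  rw [h, Measure.smul_apply, Measure.smul_apply, Measure.map_apply measurable_prodMk_left (hm hA),
    Measure.map_apply measurable_prodMk_left hA]
  congr 1
  exact measure_preimage_add_right volume (ρ ω) (Prod.mk (σ ω) ⁻¹' A)

/-- The mean of a function over the seats of all guests except the first `n` ones. -/
noncomputable def guestMean (n : ℕ) (f : VirtualPerm → ℂ) (a : Labelled (Fin n)) : ℂ :=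
  ∫ r, f (Quotient.mk _ (a.1, prepend a.2 r)) ∂guestKernel ℕ a.1

lemma measurable_mk_prepend (n : ℕ) : Measurable fun q : Labelled (Fin n) × (ℕ → Seat) =>
    (Quotient.mk (restaurantSetoid ℕ) (q.1.1, prepend q.1.2 q.2)) := by
  refine measurable_quotient_mk''.comp (measurable_fst.fst.prodMk ?_)
  exact (measurable_prepend n).comp (measurable_fst.snd.prodMk measurable_snd)

lemma measurable_guestMean (n : ℕ) {f : VirtualPerm → ℂ} (hf : Measurable f) :
    Measurable (guestMean n f) := by
  have h : StronglyMeasurable fun q : Labelled (Fin n) × (ℕ → Seat) =>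
      f (Quotient.mk (restaurantSetoid ℕ) (q.1.1, prepend q.1.2 q.2)) :=
    (hf.comp (measurable_mk_prepend n)).stronglyMeasurable
  exact (h.integral_kernel_prod_right'
    (κ := (guestKernel ℕ).comap (Prod.fst : Labelled (Fin n) → _) measurable_fst)).measurable

/-- Moving the extra guests along with the tables turns their law for `a` into their law for `b`,
and leaves the completed restaurant the same point of the quotient. Hence the mean descends to
`HalfEmpty n`. -/
lemma guestMean_eq_of_sameRestaurant {n : ℕ} {f : VirtualPerm → ℂ} (hf : Measurable f)
    {a b : Labelled (Fin n)} (hab : SameRestaurant a b) : guestMean n f a = guestMean n f b := by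
  obtain ⟨σ, ρ, h1, h2⟩ := hab
  have hm := measurable_moveSeat σ ρ
  have hk : guestKernel ℕ b.1 = (guestKernel ℕ a.1).map fun r i => moveSeat σ ρ (r i) := by
    change Measure.infinitePi (fun _ : ℕ => seatMeasure b.1) =
      (Measure.infinitePi fun _ : ℕ => seatMeasure a.1).map _
    rw [Measure.infinitePi_map_pi _ fun _ => hm]
    simp only [seatMeasure_map_moveSeat h1]
  have hg : Measurable fun r => f (Quotient.mk (restaurantSetoid ℕ) (b.1, prepend b.2 r)) :=
    hf.comp ((measurable_mk_prepend n).comp (measurable_prodMk_left (x := b)))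
  have hmr : Measurable fun (r : ℕ → Seat) i => moveSeat σ ρ (r i) :=
    measurable_pi_lambda _ fun i => hm.comp (measurable_pi_apply i)
  rw [guestMean, guestMean, hk, integral_map hmr.aemeasurable hg.aestronglyMeasurable]
  refine integral_congr_ae (.of_forall fun r => congrArg f (Quotient.sound ⟨σ, ρ, h1, fun i => ?_⟩))
  simp only [prepend]
  split_ifs with h
  · exact h2 _
  · rfl

lemma forget_permute {n : ℕ} {g : Equiv.Perm ℕ} (hg : g ∈ fixFirst n) (x : VirtualPerm) :
    forget n (permute g x) = forget n x := by
  induction x using Quotient.inductionOn with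
  | h a =>
    have (j : Fin n) : g⁻¹ j = j := (fixFirst n).inv_mem hg j j.2
    change Quotient.mk _ (a.1, fun j : Fin n => a.2 (g⁻¹ j)) = _
    simp only [this]
    rfl

/-- A function on virtual permutations which is invariant under `K_n` depends, up to a null set,
only on the restaurant with the first `n` guests. -/
theorem exists_ae_eq_comp_forget (z : ℝ) [Fact (0 < z)] (n : ℕ) {f : VirtualPerm → ℂ}
    (hf : Measurable f) (hinv : ∀ g ∈ fixFirst n, f ∘ permute g =ᵐ[law z ℕ] f) :
    ∃ h : HalfEmpty n → ℂ, Measurable h ∧ f =ᵐ[law z ℕ] h ∘ forget n := by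
  refine ⟨Quotient.lift (guestMean n f) fun _ _ h => guestMean_eq_of_sameRestaurant hf h,
    measurable_from_quotient.2 (measurable_guestMean n hf), ?_⟩
  set F : Labelled ℕ → ℂ := fun a => f (Quotient.mk _ a) with hF
  have hFm : Measurable F := hf.comp measurable_quotient_mk''
  have hrm : Measurable fun a : Labelled ℕ => ((a.1, a.2 ∘ Fin.val) : Labelled (Fin n)) := by
    fun_prop
  -- `permute g` composes seats with `g⁻¹`, so invariance is applied to the inverse of the shifted
  -- swap.
  have h1 : ∀ k, ∀ᵐ l ∂poissonDirichlet z, ∀ᵐ x ∂guestKernel ℕ l,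
      F (l, x ∘ shiftPerm n (blockSwap k)) = F (l, x) := by
    intro k
    have h := ae_of_ae_map measurable_quotient_mk''.aemeasurable
      (hinv (shiftPerm n (blockSwap k))⁻¹ ((fixFirst n).inv_mem (shiftPerm_mem n _)))
    simpa only [Function.comp_apply, permute, inv_inv] using! Measure.ae_ae_of_ae_compProd h
  have h2 : ∀ᵐ l ∂poissonDirichlet z, ∀ᵐ x ∂guestKernel ℕ l,
      F (l, x) = guestMean n f (l, x ∘ Fin.val) := by
    filter_upwards [ae_all_iff.2 h1] with l hl
    change ∀ᵐ x ∂(Measure.infinitePi fun _ : ℕ => seatMeasure l), _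
    have hl' (k : ℕ) : ∀ᵐ x ∂(Measure.infinitePi fun _ : ℕ => seatMeasure l),
      F (l, x ∘ shiftPerm n (blockSwap k)) = F (l, x) := hl k
    have hFl : Measurable fun x => F (l, x) := hFm.comp measurable_prodMk_left
    rw [← prod_map_prepend n] at hl' ⊢
    have hgm : Measurable fun x : ℕ → Seat => guestMean n f (l, x ∘ Fin.val) :=
      (measurable_guestMean n hf).comp (by fun_prop)
    rw [ae_map_iff (measurable_prepend n).aemeasurable (measurableSet_eq_fun hFl hgm)]
    -- Fubini: fix the seats `y` of the first `n` guests; the shifted swaps then act on the tail `r`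
    -- alone, as `blockSwap k`.
    refine (Measure.ae_prod_iff_ae_ae ?_).2 ?_
    · exact measurableSet_eq_fun (hFl.comp (measurable_prepend n))
        (hgm.comp (measurable_prepend n))
    · have hl2 := ae_all_iff.2 fun k => Measure.ae_ae_of_ae_prod
        (ae_of_ae_map (measurable_prepend n).aemeasurable (hl' k))
      simp only [prepend_comp_shiftPerm, prepend_comp_val] at hl2 ⊢
      filter_upwards [ae_all_iff.2 fun k => Measure.ae_ae_of_ae_prod
        (ae_of_ae_map (measurable_prepend n).aemeasurable (hl' k))] with y hy
      simp only [prepend_comp_shiftPerm] at hy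
      obtain ⟨c, hc⟩ := exists_ae_eq_const_of_blockSwap (seatMeasure l)
        (f := fun r => F (l, prepend y r))
        (hFl.comp ((measurable_prepend n).comp measurable_prodMk_left)) hy
      -- The constant is the mean, since the law of the tail is a probability measure.
      have : guestMean n f (l, y) = c := by
        have := integral_congr_ae hc
        simpa using! this
      rw [this]
      exact hc
  have h3 : ∀ᵐ a ∂labelledLaw z ℕ, F a = guestMean n f (a.1, a.2 ∘ Fin.val) :=
    (Measure.ae_compProd_iff
      (measurableSet_eq_fun hFm ((measurable_guestMean n hf).comp hrm))).2 h2
  refine (ae_map_iff measurable_quotient_mk''.aemeasurable ?_).2 h3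
  exact measurableSet_eq_fun hf
    (Measurable.comp (measurable_from_quotient.2 (measurable_guestMean n hf))
      (measurable_reindex Fin.val))

/-! ### A complete invariant of restaurants with finitely many guests -/

/-- The total length of the tables of length at most `q`. -/
noncomputable def lengthCdf (l : TableLengths) (q : ℝ) : ℝ≥0∞ :=
  ∑' ω, if l.1 ω ≤ q then ENNReal.ofReal (l.1 ω) else 0

/-- The distribution of the length of the table of a uniformly seated guest. -/
noncomputable def lengthMeasure (l : TableLengths) : Measure ℝ :=
  Measure.sum fun ω => ENNReal.ofReal (l.1 ω) • Measure.dirac (l.1 ω)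

lemma lengthMeasure_apply (l : TableLengths) {A : Set ℝ} [DecidablePred (· ∈ A)]
    (hA : MeasurableSet A) :
    lengthMeasure l A = ∑' ω, if l.1 ω ∈ A then ENNReal.ofReal (l.1 ω) else 0 := by
  rw [lengthMeasure, Measure.sum_apply _ hA]
  refine tsum_congr fun ω => ?_
  rw [Measure.smul_apply, Measure.dirac_apply' _ hA]
  by_cases h : l.1 ω ∈ A <;> simp [h]

instance (l : TableLengths) : IsProbabilityMeasure (lengthMeasure l) := by
  classical
  constructor
  rw [lengthMeasure_apply l .univ]
  simp only [Set.mem_univ, if_true]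
  rw [← ENNReal.ofReal_tsum_of_nonneg (fun ω => (l.2.1 ω).le) l.2.2.summable, l.2.2.tsum_eq,
    ENNReal.ofReal_one]

lemma lengthMeasure_Iic (l : TableLengths) (q : ℝ) :
    lengthMeasure l (Set.Iic q) = lengthCdf l q := by
  classical
  rw [lengthMeasure_apply l measurableSet_Iic]
  simp only [Set.mem_Iic, lengthCdf]

lemma finite_tables_of_length (l : TableLengths) {c : ℝ} (hc : 0 < c) :
    {ω | l.1 ω = c}.Finite := by
  have h := (l.2.2.summable.tendsto_cofinite_zero).eventually (gt_mem_nhds hc)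
  rw [Filter.eventually_cofinite] at h
  refine h.subset fun ω hω => ?_
  simp only [Set.mem_ofPred_eq] at hω ⊢
  simp [hω]

lemma lengthMeasure_singleton (l : TableLengths) (c : ℝ) :
    lengthMeasure l {c} = ENNReal.ofReal c * {ω | l.1 ω = c}.encard := by
  classical
  rw [lengthMeasure_apply l (measurableSet_singleton c), mul_comm, ← ENNReal.tsum_set_const,
    tsum_subtype _ fun _ => ENNReal.ofReal c]
  refine tsum_congr fun ω => ?_
  by_cases h : l.1 ω = c <;> simp [h]

/-- The values at rational points determine `lengthMeasure`, whose atom at `c` has mass `c` times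
the number of tables of length `c`; cancel `c`. -/
lemma encard_tables_eq {l l' : TableLengths} (h : ∀ q : ℚ, lengthCdf l q = lengthCdf l' q)
    {c : ℝ} (hc : 0 < c) : {ω | l.1 ω = c}.encard = {ω | l'.1 ω = c}.encard := by
  have hm : lengthMeasure l = lengthMeasure l' := by
    refine ext_of_generate_finite _ Real.borel_eq_generateFrom_Iic_rat Real.isPiSystem_Iic_rat ?_
      (by simp)
    intro s hs
    obtain ⟨q, rfl⟩ := Set.mem_iUnion.1 hs
    rw [lengthMeasure_Iic, lengthMeasure_Iic, h]
  have h1 := lengthMeasure_singleton l c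
  rw [hm, lengthMeasure_singleton l' c] at h1
  have h2 := (ENNReal.mul_right_inj (by simpa using hc) ENNReal.ofReal_ne_top).1 h1
  exact_mod_cast h2.symm

/-- A partial length-preserving bijection between finitely many tables extends to all tables. -/
lemma exists_perm_extending {I : Type} [Finite I] {l l' : TableLengths}
    (h : ∀ q : ℚ, lengthCdf l q = lengthCdf l' q) {t t' : I → ℕ}
    (ht : ∀ i, l.1 (t i) = l'.1 (t' i)) (htt : ∀ i j, t i = t j ↔ t' i = t' j) :
    ∃ σ : Equiv.Perm ℕ, (∀ ω, l'.1 (σ ω) = l.1 ω) ∧ ∀ i, σ (t i) = t' i := by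
  classical
  -- The permutation is assembled from bijections between the tables of each given length. For `c >
  -- 0` these sets are finite of equal size, so a partial injection extends to a bijection;
  -- otherwise they are empty.
  have hfib (c : ℝ) : ∃ e : {ω // l.1 ω = c} ≃ {ω // l'.1 ω = c},
      ∀ i (hi : l.1 (t i) = c), (e ⟨t i, hi⟩ : ℕ) = t' i := by
    by_cases hc : 0 < c
    · have hf := finite_tables_of_length l hc
      have hf' := finite_tables_of_length l' hc
      have : Fintype {ω // l.1 ω = c} := hf.fintype
      have hcard := encard_tables_eq h hc
      -- The partial matching: the table of guest `i` goes to the table of the same guest in the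
      -- other restaurant. The choice of guest is immaterial by `htt`, and the value 0 at unoccupied
      -- tables plays no role.
      let τ : {ω // l.1 ω = c} → ℕ := fun ω => if hω : ∃ i, t i = ω then t' hω.choose else 0
      have hτ (i : I) (hi : l.1 (t i) = c) : τ ⟨t i, hi⟩ = t' i := by
        have hω : ∃ j, t j = t i := ⟨i, rfl⟩
        have h1 : τ ⟨t i, hi⟩ = t' hω.choose := dif_pos hω
        rw [h1, ← htt]
        exact hω.choose_spec
      have hcard' : Fintype.card {ω // l.1 ω = c} = hf'.toFinset.card := by
        rw [← Set.ncard_eq_toFinset_card _ hf', ← Nat.card_eq_fintype_card]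
        exact congrArg ENat.toNat hcard
      obtain ⟨e, he⟩ := Set.MapsTo.exists_equiv_extend_of_card_eq (f := τ) hcard'
        (s := {ω : {ω // l.1 ω = c} | ∃ i, t i = ω}) (by
          rintro ⟨_, hω⟩ ⟨i, rfl⟩
          rw [hτ]
          simpa [ht i] using hω) (by
          rintro ⟨_, hω⟩ ⟨i, rfl⟩ ⟨_, hω'⟩ ⟨j, rfl⟩ hij
          rw [hτ, hτ, ← htt] at hij
          exact Subtype.ext hij)
      refine ⟨e.trans (Equiv.subtypeEquivRight fun ω => by simp), fun i hi => ?_⟩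
      exact (he ⟨t i, hi⟩ ⟨i, rfl⟩).trans (hτ i hi)
    · have h1 : IsEmpty {ω // l.1 ω = c} := ⟨fun ω => hc (ω.2 ▸ l.2.1 ω.1)⟩
      have h2 : IsEmpty {ω // l'.1 ω = c} := ⟨fun ω => hc (ω.2 ▸ l'.2.1 ω.1)⟩
      exact ⟨Equiv.equivOfIsEmpty _ _, fun i hi => h1.elim ⟨t i, hi⟩⟩
  choose e he using hfib
  refine ⟨(Equiv.sigmaFiberEquiv l.1).symm.trans
    ((Equiv.sigmaCongrRight e).trans (Equiv.sigmaFiberEquiv l'.1)), fun ω => ?_, fun i => ?_⟩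
  · exact (e (l.1 ω) ⟨ω, rfl⟩).2
  · exact he _ i rfl

/-- A complete invariant of a labelled restaurant with respect to `SameRestaurant`: the
distribution of the lengths of tables, the lengths of the occupied tables, the partition of the
guests into tables, and the angles between guests at the same table. -/
noncomputable def invariants {I : Type} (a : Labelled I) :
    (ℚ → ℝ≥0∞) × (I → ℝ) × (I × I → ℝ) × (I × I → UnitAddCircle) :=
  (fun q => lengthCdf a.1 q, fun i => a.1.1 (a.2 i).1,
    fun p => if (a.2 p.1).1 = (a.2 p.2).1 then 1 else 0,
    fun p => if (a.2 p.1).1 = (a.2 p.2).1 then (a.2 p.1).2 - (a.2 p.2).2 else 0)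

lemma measurable_invariants {I : Type} : Measurable (invariants (I := I)) := by
  have hs (i j : I) : MeasurableSet {a : Labelled I | (a.2 i).1 = (a.2 j).1} :=
    measurableSet_eq_fun (by fun_prop) (by fun_prop)
  have hl (ω : ℕ) : Measurable fun a : Labelled I => a.1.1 ω :=
    (measurable_pi_apply ω).comp (measurable_subtype_coe.comp measurable_fst)
  refine .prodMk ?_ (.prodMk ?_ (.prodMk ?_ ?_))
  · refine measurable_pi_lambda _ fun q => Measurable.tsum fun ω => ?_
    exact .ite (measurableSet_le (hl ω) measurable_const) (hl ω).ennreal_ofReal measurable_const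
  · refine measurable_pi_lambda _ fun i => ?_
    have h : Measurable fun q : TableLengths × ℕ => q.1.1 q.2 :=
      measurable_from_prod_countable_left fun ω =>
        (measurable_pi_apply ω).comp measurable_subtype_coe
    exact h.comp (f := fun a : Labelled I => (a.1, (a.2 i).1)) (by fun_prop)
  · exact measurable_pi_lambda _ fun p => .ite (hs p.1 p.2) measurable_const measurable_const
  · exact measurable_pi_lambda _ fun p => .ite (hs p.1 p.2) (by fun_prop) measurable_const

lemma invariants_eq_of_sameRestaurant {I : Type} {a b : Labelled I} (h : SameRestaurant a b) :
    invariants a = invariants b := by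
  obtain ⟨σ, ρ, h1, h2⟩ := h
  have hσ (i j : I) : (σ (a.2 i).1 = σ (a.2 j).1) = ((a.2 i).1 = (a.2 j).1) := by simp
  simp only [invariants, h2, h1, hσ, Prod.mk.injEq, true_and]
  refine ⟨funext fun q => ?_, ?_⟩
  · rw [lengthCdf, lengthCdf, ← σ.tsum_eq fun ω => if b.1.1 ω ≤ q then _ else _]
    simp only [h1]
  · ext p
    split_ifs with hij
    · rw [hij, add_sub_add_right_eq_sub]
    · rfl

/-- Equal length distributions and matching occupied tables give the relabelling. One guest per
occupied table fixes its rotation, and the angles force the other guests there to agree. Finiteness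
of `I` lets the partial matching of tables extend. -/
lemma sameRestaurant_of_invariants_eq {I : Type} [Finite I] {a b : Labelled I}
    (h : invariants a = invariants b) : SameRestaurant a b := by
  classical
  simp only [invariants, Prod.mk.injEq] at h
  obtain ⟨h1, h2, h3, h4⟩ := h
  have htt (i j : I) : (a.2 i).1 = (a.2 j).1 ↔ (b.2 i).1 = (b.2 j).1 := by
    have := congrFun h3 (i, j)
    by_cases hij : (a.2 i).1 = (a.2 j).1 <;> by_cases hij' : (b.2 i).1 = (b.2 j).1 <;>
      simp_all
  obtain ⟨σ, hσ, hσt⟩ := exists_perm_extending (congrFun h1) (congrFun h2) htt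
  refine ⟨σ, fun ω => if hω : ∃ i, (a.2 i).1 = ω then
    (b.2 hω.choose).2 - (a.2 hω.choose).2 else 0, hσ, fun i => ?_⟩
  have hω : ∃ j, (a.2 j).1 = (a.2 i).1 := ⟨i, rfl⟩
  have hj := hω.choose_spec
  have hang := congrFun h4 (i, hω.choose)
  rw [if_pos hj.symm, if_pos ((htt _ _).1 hj.symm)] at hang
  refine Prod.ext (hσt i).symm ?_
  simp only [dif_pos hω]
  rw [eq_sub_iff_add_eq] at hang
  rw [← hang]
  abel

lemma exists_separating_seq (I : Type) [Finite I] : ∃ F : ℕ → Set (Occupied I),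
    (∀ k, MeasurableSet (F k)) ∧ ∀ x y, (∀ k, x ∈ F k ↔ y ∈ F k) → x = y := by
  have := Fintype.ofFinite I
  have hg : MeasurableSpace.CountablyGenerated ((I × I → ℝ) × (I × I → UnitAddCircle)) :=
    inferInstance
  have hg' : MeasurableSpace.CountablyGenerated
      ((I → ℝ) × (I × I → ℝ) × (I × I → UnitAddCircle)) :=
    @MeasurableSpace.instCountablyGeneratedProd _ _ _ inferInstance _ hg
  have hg'' : MeasurableSpace.CountablyGenerated
      ((ℚ → ℝ≥0∞) × (I → ℝ) × (I × I → ℝ) × (I × I → UnitAddCircle)) :=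
    @MeasurableSpace.instCountablyGeneratedProd _ _ _ inferInstance _ hg'
  have hcs : MeasurableSpace.CountablySeparated
      ((ℚ → ℝ≥0∞) × (I → ℝ) × (I × I → ℝ) × (I × I → UnitAddCircle)) :=
    MeasurableSpace.countablySeparated_of_separatesPoints
  obtain ⟨S, hS, hsep⟩ := exists_seq_separating
    ((ℚ → ℝ≥0∞) × (I → ℝ) × (I × I → ℝ) × (I × I → UnitAddCircle)) MeasurableSet.univ Set.univ
  let Φ : Occupied I → _ := Quotient.lift invariants fun _ _ h => invariants_eq_of_sameRestaurant h
  have hΦ : Measurable Φ := measurable_from_quotient.2 measurable_invariants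
  refine ⟨fun k => Φ ⁻¹' S k, fun k => hΦ (hS k), fun x y h => ?_⟩
  have hxy := hsep (Φ x) trivial (Φ y) trivial h
  induction x, y using Quotient.inductionOn₂ with
  | h a b => exact Quotient.sound (sameRestaurant_of_invariants_eq hxy)

/-! ### Invariant sets and the quotient space -/

lemma preimage_forget_mem_invariantSets (z : ℝ) (n : ℕ) {E : Set (HalfEmpty n)}
    (hE : MeasurableSet E) : forget n ⁻¹' E ∈ invariantSets z n := by
  refine ⟨measurable_reindex _ hE, fun g hg => ?_⟩
  have : permute g ⁻¹' (forget n ⁻¹' E) = forget n ⁻¹' E := by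
    ext x
    simp only [Set.mem_preimage, forget_permute hg]
  rw [this, symmDiff_self]
  exact measure_empty

theorem mem_invariantSets_iff (z : ℝ) [Fact (0 < z)] (n : ℕ) (B : Set VirtualPerm) :
    B ∈ invariantSets z n ↔ MeasurableSet B ∧ ∃ E : Set (HalfEmpty n), MeasurableSet E ∧
      law z ℕ (symmDiff B (forget n ⁻¹' E)) = 0 := by
  refine ⟨fun ⟨hB, hinv⟩ => ⟨hB, ?_⟩, fun ⟨hB, E, hE, hBE⟩ => ⟨hB, fun g hg => ?_⟩⟩
  · obtain ⟨h, hm, hh⟩ := exists_ae_eq_comp_forget z n (f := B.indicator 1)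
      (measurable_one.indicator hB) fun g hg => by
        filter_upwards [(measure_symmDiff_eq_zero_iff.1 (hinv g hg)).mem_iff] with x hx
        by_cases hxB : x ∈ B
        · have hgx : permute g x ∈ B := hx.1 hxB
          simp [hxB, hgx]
        · have hgx : permute g x ∉ B := fun h => hxB (hx.2 h)
          simp [hxB, hgx]
    -- The function `h` need be an indicator only almost everywhere after composition with `forget
    -- n`; its level set at 1 recovers `B` up to a null set.
    refine ⟨h ⁻¹' {1}, hm (measurableSet_singleton 1), ?_⟩
    rw [measure_symmDiff_eq_zero_iff]
    filter_upwards [hh] with x hx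
    refine propext ?_
    change x ∈ B ↔ h (forget n x) = 1
    rw [show h (forget n x) = _ from hx.symm]
    by_cases hxB : x ∈ B <;> simp [hxB]
  -- `permute g` preserves null sets, so invariance passes from `forget n ⁻¹' E` to the almost equal
  -- set `B`.
  · rw [measure_symmDiff_eq_zero_iff] at hBE ⊢
    have h := (measurePreserving_permute z g).quasiMeasurePreserving.preimage_ae_eq hBE
    have h' := (preimage_forget_mem_invariantSets z n hE).2 g hg
    rw [measure_symmDiff_eq_zero_iff] at h'
    exact hBE.trans (h'.trans h.symm)

lemma forget_surjective (n : ℕ) : Function.Surjective (forget n) := by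
  intro y
  induction y using Quotient.inductionOn with
  | h a =>
    refine ⟨Quotient.mk _ (a.1, prepend a.2 fun _ => default), ?_⟩
    exact congrArg (fun y => Quotient.mk _ (a.1, y)) (prepend_comp_val a.2 fun _ => default)

/-- Seating all extra guests at one default seat is a measurable map of labelled restaurants that
`forget n` undoes; pulling back along it recovers `E`. -/
lemma measurableSet_iff_preimage_forget (n : ℕ) (E : Set (HalfEmpty n)) :
    MeasurableSet E ↔ MeasurableSet (forget n ⁻¹' E) := by
  refine ⟨fun h => measurable_reindex _ h, fun h => ?_⟩
  have hm := (measurable_mk_prepend n).comp (measurable_prodMk_right (y := fun _ => default)) h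
  rw [measurableSet_quotient]
  convert! hm using 1
  ext a
  change Quotient.mk _ a ∈ E ↔ Quotient.mk _ (a.1, prepend a.2 _ ∘ Fin.val) ∈ E
  rw [prepend_comp_val]

/-- Separability is only required upstairs, on `X`. The approximating sets `A` there need not come
from `S`, so for each `A a` and each tolerance a member of `S` that close to it is picked whenever
one exists; the triangle inequality gives density. -/
lemma exists_isDenseSeq_of_isSeparable {X Y : Type*} [MeasurableSpace X] [MeasurableSpace Y]
    {μ : Measure X} [IsFiniteMeasure μ] [IsSeparable μ] {π : X → Y} (hπ : Measurable π)
    {S : Set (Set Y)} (hS : ∀ B ∈ S, MeasurableSet B) (hne : S.Nonempty) :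
    ∃ C, IsDenseSeq (μ.map π) S C := by
  classical
  obtain ⟨𝒜, hc, hd⟩ := exists_countable_measureDense (μ := μ)
  obtain ⟨A, rfl⟩ := hc.exists_eq_range hd.nonempty
  obtain ⟨B₀, hB₀⟩ := hne
  let P (p : ℕ × ℕ) (B : Set Y) : Prop :=
    B ∈ S ∧ μ (symmDiff (π ⁻¹' B) (A p.1)) < ENNReal.ofReal (1 / (p.2 + 1))
  let C (p : ℕ × ℕ) : Set Y := if h : ∃ B, P p B then h.choose else B₀
  have hCS (p : ℕ × ℕ) : C p ∈ S := by
    by_cases h : ∃ B, P p B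
    · simpa only [C, dif_pos h] using h.choose_spec.1
    · simpa only [C, dif_neg h] using hB₀
  refine ⟨fun j => C j.unpair, fun j => hCS _, fun B hB ε hε => ?_⟩
  obtain ⟨m, hm⟩ : ∃ m : ℕ, ENNReal.ofReal (1 / (m + 1)) < ε / 2 := by
    have h := ENNReal.tendsto_ofReal (tendsto_one_div_add_atTop_nhds_zero_nat (𝕜 := ℝ))
    rw [ENNReal.ofReal_zero] at h
    exact (h.eventually (gt_mem_nhds (ENNReal.half_pos hε.ne'))).exists
  obtain ⟨_, ⟨a, rfl⟩, ha⟩ := hd.approx (π ⁻¹' B) (hπ (hS B hB)) (measure_ne_top _ _)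
    (1 / (m + 1)) (by positivity)
  have hex : ∃ B, P (a, m) B := ⟨B, hB, ha⟩
  have hC : P (a, m) (C (a, m)) := by
    simpa only [C, dif_pos hex] using hex.choose_spec
  refine ⟨Nat.pair a m, ?_⟩
  simp only [Nat.unpair_pair]
  rw [Measure.map_apply hπ ((hS B hB).symmDiff (hS _ (hCS _))), Set.preimage_symmDiff]
  calc μ (symmDiff (π ⁻¹' B) (π ⁻¹' C (a, m)))
      ≤ μ (symmDiff (π ⁻¹' B) (A a)) + μ (symmDiff (A a) (π ⁻¹' C (a, m))) :=
        measure_symmDiff_le _ _ _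
    _ < ε / 2 + ε / 2 := by
        refine ENNReal.add_lt_add (ha.trans hm) ?_
        rw [symmDiff_comm]
        exact hC.2.trans hm
    _ = ε := ENNReal.add_halves ε

/-- A dense sequence in a `σ`-algebra `S` which coincides up to null sets with the preimage of the
`σ`-algebra of `Y` determines the partition into the fibres of `π`. -/
lemma exists_conull_partition_eq {X Y : Type*} [MeasurableSpace X] [MeasurableSpace Y]
    {μ : Measure X} {π : X → Y} {S : Set (Set X)} {C : ℕ → Set X}
    (hC : IsDenseSeq μ S C) (hπS : ∀ E, MeasurableSet E → π ⁻¹' E ∈ S)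
    (hSπ : ∀ B ∈ S, ∃ E, MeasurableSet E ∧ μ (symmDiff B (π ⁻¹' E)) = 0)
    {F : ℕ → Set Y} (hF : ∀ k, MeasurableSet (F k))
    (hsep : ∀ x y, (∀ k, x ∈ F k ↔ y ∈ F k) → x = y) :
    ∃ X₀ : Set X, MeasurableSet X₀ ∧ μ X₀ᶜ = 0 ∧
      ∀ x ∈ X₀, ∀ y ∈ X₀, (∀ j, x ∈ C j ↔ y ∈ C j) ↔ π x = π y := by
  choose E hE hCE using fun j => hSπ _ (hC.1 j)
  have h1 : ∀ᵐ x ∂μ, ∀ j, x ∈ C j ↔ π x ∈ E j :=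
    ae_all_iff.2 fun j => (measure_symmDiff_eq_zero_iff.1 (hCE j)).mem_iff
  -- Approximation errors `2⁻ᵐ` are summable, so by Borel–Cantelli almost every point lies in `C (J
  -- k m)` exactly when its image lies in `F k`, for all large `m`.
  choose J hJ using fun k m : ℕ => hC.2 _ (hπS _ (hF k)) ((1 / 2 : ℝ≥0∞) ^ m)
    (by simp [pos_iff_ne_zero])
  have h2 : ∀ᵐ x ∂μ, ∀ k, ∀ᶠ m in Filter.atTop, (π x ∈ F k ↔ x ∈ C (J k m)) := by
    refine ae_all_iff.2 fun k => ?_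
    have hsum : ∑' m, μ (symmDiff (π ⁻¹' F k) (C (J k m))) ≠ ∞ := by
      refine ne_top_of_le_ne_top ?_ (ENNReal.tsum_le_tsum fun m => (hJ k m).le)
      rw [ENNReal.tsum_geometric]
      simp
    filter_upwards [ae_eventually_notMem hsum] with x hx
    filter_upwards [hx] with m hm
    rw [Set.mem_symmDiff, Set.mem_preimage] at hm
    tauto
  have h3 := h1.and h2
  obtain ⟨t, ht, htm, ht0⟩ := exists_measurable_superset_of_null (ae_iff.1 h3)
  have hX₀ (x : X) (hx : x ∈ tᶜ) := not_not.1 fun h => hx (ht h)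
  refine ⟨tᶜ, htm.compl, by rwa [compl_compl], fun x hx y hy => ⟨fun h => ?_, fun h j => ?_⟩⟩
  · refine hsep _ _ fun k => ?_
    -- A single `m` serves both points, so membership in one `C j` decides `F k` for both.
    obtain ⟨m, hmx, hmy⟩ := (((hX₀ x hx).2 k).and ((hX₀ y hy).2 k)).exists
    rw [hmx, hmy, h]
  · rw [(hX₀ x hx).1, (hX₀ y hy).1, h]

lemma isSeparable_labelledLaw (z : ℝ) [Fact (0 < z)] : IsSeparable (labelledLaw z ℕ) := by
  have h1 : MeasurableSpace.CountablyGenerated (ℕ → Seat) := inferInstance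
  have h2 : MeasurableSpace.CountablyGenerated TableLengths := inferInstance
  infer_instance

theorem isQuotientSpace_forget (z : ℝ) [Fact (0 < z)] (n : ℕ) :
    IsQuotientSpace (law z ℕ) (invariantSets z n) (forget n) (law z (Fin n)) where
  surjective := forget_surjective n
  measurableSet_iff := measurableSet_iff_preimage_forget n
  map_eq := (measurePreserving_forget z n).map_eq
  exists_dense := by
    have := isSeparable_labelledLaw z
    exact exists_isDenseSeq_of_isSeparable measurable_quotient_mk'' (fun B hB => hB.1)
      ⟨_, preimage_forget_mem_invariantSets z n .univ⟩
  partition_eq C hC := by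
    obtain ⟨F, hF, hsep⟩ := exists_separating_seq (Fin n)
    exact exists_conull_partition_eq hC
      (fun E hE => preimage_forget_mem_invariantSets z n hE)
      (fun B hB => ((mem_invariantSets_iff z n B).1 hB).2) hF hsep

/-! ### Fixed vectors -/

theorem fixedVectors_eq_range (z : ℝ) [Fact (0 < z)] (n : ℕ) :
    {f : Lp ℂ 2 (law z ℕ) | ∀ g ∈ fixFirst n,
        Lp.compMeasurePreserving (permute g) (measurePreserving_permute z g) f = f} =
      Set.range (Lp.compMeasurePreserving (E := ℂ) (p := 2) (forget n)
        (measurePreserving_forget z n)) := by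
  ext f
  constructor
  · intro hf
    have hfm := (Lp.stronglyMeasurable f).measurable
    obtain ⟨h, hm, hh⟩ := exists_ae_eq_comp_forget z n hfm fun g hg =>
      (Lp.coeFn_compMeasurePreserving f (measurePreserving_permute z g)).symm.trans
        (by rw [hf g hg])
    -- Square integrability descends because `forget n` preserves measure.
    have hL : MemLp h 2 (law z (Fin n)) := by
      rw [← (measurePreserving_forget z n).map_eq,
        memLp_map_measure_iff hm.aestronglyMeasurable
          (measurePreserving_forget z n).aemeasurable]
      exact (memLp_congr_ae hh).1 (Lp.memLp f)
    refine ⟨hL.toLp h, ?_⟩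
    rw [Lp.toLp_compMeasurePreserving]
    exact Lp.ext ((MemLp.coeFn_toLp _).trans hh.symm)
  · rintro ⟨h, rfl⟩ g hg
    rw [← Lp.compMeasurePreserving_comp_apply]
    congr 1
    have : forget n ∘ permute g = forget n := funext (forget_permute hg)
    simp only [this]

end Restaurant

theorem mainTheorem6 (z : ℝ) [Fact (0 < z)] (n : ℕ) :
    Restaurant.IsQuotientSpace (Restaurant.law z ℕ) (Restaurant.invariantSets z n)
      (Restaurant.forget n) (Restaurant.law z (Fin n)) ∧
    (∀ B : Set Restaurant.VirtualPerm, B ∈ Restaurant.invariantSets z n ↔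
      MeasurableSet B ∧ ∃ E : Set (Restaurant.HalfEmpty n), MeasurableSet E ∧
        Restaurant.law z ℕ (symmDiff B (Restaurant.forget n ⁻¹' E)) = 0) ∧
    {f : Lp ℂ 2 (Restaurant.law z ℕ) | ∀ g ∈ Restaurant.fixFirst n,
        Lp.compMeasurePreserving (Restaurant.permute g)
          (Restaurant.measurePreserving_permute z g) f = f} =
      Set.range (Lp.compMeasurePreserving (E := ℂ) (p := 2) (Restaurant.forget n)
        (Restaurant.measurePreserving_forget z n)) :=
  ⟨Restaurant.isQuotientSpace_forget z n, Restaurant.mem_invariantSets_iff z n,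
    Restaurant.fixedVectors_eq_range z n⟩
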